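/- Let $M$ be a Riemann surface. A \emph{Weierstrass representation} of $M$ is a smooth nowhere vanishing $\mathbb{C}^3$-valued $(1,0)$-form $\omega=(\omega_1,\omega_2,\omega_3)$ on $M$ with $\omega_1^2+\omega_2^2+\omega_3^2=0$; it satisfies the \emph{integrability condition} if $\mathrm{Re}(d\omega)=0$. For a complex line bundle $E$ write $E^{*1,0}$ and $E^{*0,1}$ for the bundles of $\mathbb{C}$-linear and $\mathbb{C}$-antilinear functionals on $E$; complex conjugation $\xi\mapsto\bar\xi$ interchanges them. A \emph{spinor representation} $(S,u,v)$ of $M$ consists of a holomorphic line bundle $S\to M$ with a holomorphic bundle map $S\twoheadrightarrow TM$, $w\mapsto w^2$, that is complex-quadratic and surjective on each fiber, and of two smooth sections $u,v$ of $S^{*1,0}$ that do not vanish simultaneously. It \emph{corresponds} to $\omega$ if $(u,v)\colon S\to\mathbb{C}^2$ is a lift of $\omega$ through the quadratic map $\theta(z_0,z_1)=(z_0^2-z_1^2,\ i(z_0^2+z_1^2),\ 2z_0z_1)$, that is, $\omega(w^2)=\theta(u(w),v(w))$ for all $w\in S$. Given a Weierstrass representation $\omega$ and a square root $S\twoheadrightarrow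 TM$, let $\sqrt h$ be the Hermitian metric on $S$ with $\sqrt h(w,w)=\|\omega(w^2)\|$, linear in the first and antilinear in the second argument. It is a section of $S^{*1,0}\otimes S^{*0,1}$, and multiplication by it gives isomorphisms $$\tau_{1,0}\colon S^{*1,0}\to T^{*1,0}M\otimes S^{*0,1},\qquad \tau_{0,1}\colon S^{*0,1}\to T^{*0,1}M\otimes S^{*1,0},$$ $\tau_{1,0}(\xi)(s^2,w)=\xi(s)\sqrt h(s,w)$ and $\tau_{0,1}(\xi)(s^2,w)=\xi(s)\sqrt h(w,s)$ for $s,w\in S_p$. Let $\bar\partial\colon\Gamma(S^{*1,0})\to\Gamma(T^{*0,1}M\otimes S^{*1,0})$ be the Dolbeault operator of the holomorphic line bundle $S^{*1,0}$ and $\partial\colon\Gamma(S^{*0,1})\to\Gamma(T^{*1,0}M\otimes S^{*0,1})$ its complex conjugate. The Dirac operator $D$ is $\tau_{0,1}^{-1}\circ\bar\partial\colon\Gamma(S^{*1,0})\to\Gamma(S^{*0,1})$ on sections of $S^{*1,0}$ and $\tau_{1,0}^{-1}\circ\partial\colon\Gamma(S^{*0,1})\to\Gamma(S^{*1,0})$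 on sections of $S^{*0,1}$. \textbf{Proposition.} Let $\omega$ be a Weierstrass representation of a Riemann surface $M$ and let $(S,u,v)$ be a spinor representation of $M$ corresponding to $\omega$. Then $\mathrm{Re}(d\omega)=0$ if and only if the following two identities of sections of $S^{*1,0}\otimes S^{*0,1}$ hold on $M$: $$v\otimes Dv=-D\bar u\otimes\bar u,\qquad u\otimes Dv+v\otimes Du=D\bar v\otimes\bar u+D\bar u\otimes\bar v.$$ -/

import Mathlib

open scoped Manifold ContDiff TensorProduct
open Bundle

namespace SpinorSurface

/-! ### Exterior derivative and Cauchy-Riemann operators on a Riemann surface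

A Riemann surface is a space `M` with charts in `ℂ` and holomorphic transition maps,
i.e. `[IsManifold 𝓘(ℂ, ℂ) ω M]`. The complex line `T_p M` is `TangentSpace 𝓘(ℂ, ℂ) p`; its
underlying real plane is `TangentSpace 𝓘(ℝ, ℂ) p`, and multiplication by `Complex.I` is the
complex structure. -/

section Surface

variable {M : Type*} [TopologicalSpace M] [ChartedSpace ℂ M]

/-- The exterior derivative of a real-linear vector-valued 1-form `α` on a surface: pull `α` back
to the plane by the inverse of a chart around `p`, take the exterior derivative there, and pull the
result back to `T_p M` by the chart. -/
noncomputable def extDerivOneForm {F : Type*} [NormedAddCommGroup F] [NormedSpace ℝ F]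
    (α : ∀ p : M, TangentSpace 𝓘(ℝ, ℂ) p →L[ℝ] F) (p : M) :
    TangentSpace 𝓘(ℝ, ℂ) p [⋀^Fin 2]→L[ℝ] F :=
  (extDeriv (fun z : ℂ => ContinuousAlternatingMap.ofSubsingleton ℝ ℂ F (0 : Fin 1)
      ((α ((extChartAt 𝓘(ℝ, ℂ) p).symm z)).comp
        (mfderiv 𝓘(ℝ, ℂ) 𝓘(ℝ, ℂ) (extChartAt 𝓘(ℝ, ℂ) p).symm z)))
    (extChartAt 𝓘(ℝ, ℂ) p p)).compContinuousLinearMap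
      (mfderiv 𝓘(ℝ, ℂ) 𝓘(ℝ, ℂ) (extChartAt 𝓘(ℝ, ℂ) p) p)

/-- The real differential `df_p : T_p M → ℂ` of a complex-valued function. -/
noncomputable def realDiff (f : M → ℂ) (p : M) : TangentSpace 𝓘(ℂ, ℂ) p →L[ℝ] ℂ :=
  mfderiv 𝓘(ℝ, ℂ) 𝓘(ℝ, ℂ) f p

lemma realDiff_smul (f : M → ℂ) (p : M) (c : ℂ) (X : TangentSpace 𝓘(ℂ, ℂ) p) :
    realDiff f p (c • X) = c.re * realDiff f p X + c.im * realDiff f p (Complex.I • X) := by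
  have h : c • X = c.re • X + c.im • (Complex.I • X) := by
    change (c * (show ℂ from X) : ℂ) = c.re * (show ℂ from X) + c.im * (Complex.I * (show ℂ from X))
    conv_lhs => rw [← Complex.re_add_im c]
    ring
  rw [h, map_add, map_smul, map_smul, Complex.real_smul, Complex.real_smul]

/-- `∂f = (df - i I^* df) / 2`, the complex-linear part of the differential. -/
noncomputable def del (f : M → ℂ) (p : M) : TangentSpace 𝓘(ℂ, ℂ) p →ₗ[ℂ] ℂ where
  toFun X := (realDiff f p X - Complex.I * realDiff f p (Complex.I • X)) / 2
  map_add' X Y := by rw [smul_add, map_add, map_add]; ring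
  map_smul' c X := by
    rw [smul_smul, mul_comm Complex.I c, ← smul_smul, realDiff_smul f p c X,
      realDiff_smul f p c (Complex.I • X), smul_smul, Complex.I_mul_I, neg_one_smul, map_neg,
      RingHom.id_apply, smul_eq_mul]
    conv_rhs => rw [← Complex.re_add_im c]
    linear_combination (-(c.im : ℂ) / 2 * realDiff f p (Complex.I • X)) * Complex.I_sq * (-1)

/-- `∂̄f = (df + i I^* df) / 2`, the antilinear part of the differential. -/
noncomputable def delbar (f : M → ℂ) (p : M) : TangentSpace 𝓘(ℂ, ℂ) p →ₛₗ[starRingEnd ℂ] ℂ where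
  toFun X := (realDiff f p X + Complex.I * realDiff f p (Complex.I • X)) / 2
  map_add' X Y := by rw [smul_add, map_add, map_add]; ring
  map_smul' c X := by
    have hc : (starRingEnd ℂ) c = c.re - c.im * Complex.I := by
      apply Complex.ext <;> simp
    rw [smul_smul, mul_comm Complex.I c, ← smul_smul, realDiff_smul f p c X,
      realDiff_smul f p c (Complex.I • X), smul_smul, Complex.I_mul_I, neg_one_smul, map_neg,
      smul_eq_mul, hc]
    linear_combination ((c.im : ℂ) / 2 * realDiff f p (Complex.I • X)) * Complex.I_sq

end Surface

/-! ### Weierstrass representations -/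

/-- A (generalized) Weierstrass representation of `M`: a smooth nowhere vanishing `ℂ³`-valued
`(1,0)`-form with `ω₁² + ω₂² + ω₃² = 0`. Smoothness is that of the map `TM → ℂ³`. -/
structure WeierstrassRepresentation (M : Type*) [TopologicalSpace M] [ChartedSpace ℂ M]
    [IsManifold 𝓘(ℂ, ℂ) ω M] where
  form : ∀ p : M, TangentSpace 𝓘(ℂ, ℂ) p →L[ℂ] EuclideanSpace ℂ (Fin 3)
  smooth : ContMDiff (𝓘(ℝ, ℂ).prod 𝓘(ℝ, ℂ)) 𝓘(ℝ, EuclideanSpace ℂ (Fin 3)) ∞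
    (fun X : TangentBundle 𝓘(ℂ, ℂ) M => form X.1 X.2)
  nonvanishing : ∀ p, form p ≠ 0
  isotropic : ∀ (p : M) (X : TangentSpace 𝓘(ℂ, ℂ) p), ∑ i, (form p X i) ^ 2 = 0

namespace WeierstrassRepresentation

variable {M : Type*} [TopologicalSpace M] [ChartedSpace ℂ M] [IsManifold 𝓘(ℂ, ℂ) ω M]

/-- The underlying real-linear `ℂ³`-valued 1-form. -/
noncomputable def realForm (W : WeierstrassRepresentation M) (p : M) :
    TangentSpace 𝓘(ℝ, ℂ) p →L[ℝ] EuclideanSpace ℂ (Fin 3) :=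
  (W.form p).restrictScalars ℝ

/-- The integrability condition `Re(dω) = 0`. -/
def Integrable (W : WeierstrassRepresentation M) : Prop :=
  ∀ (p : M) (X : Fin 2 → TangentSpace 𝓘(ℝ, ℂ) p) (i : Fin 3),
    (extDerivOneForm W.realForm p X i).re = 0

lemma form_ne_zero (W : WeierstrassRepresentation M) (p : M) {X : TangentSpace 𝓘(ℂ, ℂ) p}
    (hX : X ≠ 0) : W.form p X ≠ 0 := by
  intro h
  apply W.nonvanishing p
  refine ContinuousLinearMap.ext fun Y => ?_
  have hX' : (show ℂ from X) ≠ 0 := hX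
  have hY : Y = ((show ℂ from Y) / (show ℂ from X)) • X := by
    change (show ℂ from Y) = ((show ℂ from Y) / (show ℂ from X)) * (show ℂ from X)
    field_simp
  rw [hY, map_smul, h, smul_zero]
  rfl

end WeierstrassRepresentation

/-! ### Fiber coordinates and local frames of a line bundle -/

section LineBundle

variable {M : Type*} [TopologicalSpace M]
  (S : M → Type*) [TopologicalSpace (TotalSpace ℂ S)] [∀ p, AddCommGroup (S p)]
  [∀ p, Module ℂ (S p)] [∀ p, TopologicalSpace (S p)] [FiberBundle ℂ S] [VectorBundle ℂ ℂ S]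

/-- The coordinate on the fiber `S_p` given by the preferred holomorphic trivialization at `p`. -/
noncomputable def fiberCoord (p : M) : S p ≃ₗ[ℂ] ℂ :=
  (trivializationAt ℂ S p).linearEquivAt ℂ p (mem_baseSet_trivializationAt ℂ S p)

/-- The local holomorphic frame `x ↦ e(x) ∈ S_x` of `S` on a neighborhood of `p` given by the
preferred holomorphic trivialization at `p`. -/
noncomputable def localFrame (p x : M) : S x :=
  (trivializationAt ℂ S p).symm x 1

variable {S}

lemma fiberCoord_smul_localFrame (p : M) (w : S p) :
    fiberCoord S p w • localFrame S p p = w := by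
  have h : localFrame S p p = (fiberCoord S p).symm 1 :=
    (Trivialization.linearEquivAt_symm_apply (R := ℂ) _ p (mem_baseSet_trivializationAt ℂ S p) 1).symm
  rw [h, ← map_smul, smul_eq_mul, mul_one, LinearEquiv.symm_apply_apply]

lemma fiberCoord_localFrame (p : M) : fiberCoord S p (localFrame S p p) = 1 := by
  have h : localFrame S p p = (fiberCoord S p).symm 1 :=
    (Trivialization.linearEquivAt_symm_apply (R := ℂ) _ p (mem_baseSet_trivializationAt ℂ S p) 1).symm
  rw [h, LinearEquiv.apply_symm_apply]

end LineBundle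

/-! ### Square roots of the tangent bundle and spinor representations -/

section Spinors

variable {M : Type*} [TopologicalSpace M] [ChartedSpace ℂ M] [IsManifold 𝓘(ℂ, ℂ) ω M]
  (S : M → Type*) [TopologicalSpace (TotalSpace ℂ S)] [∀ p, AddCommGroup (S p)]
  [∀ p, Module ℂ (S p)] [∀ p, TopologicalSpace (S p)] [FiberBundle ℂ S] [VectorBundle ℂ ℂ S]

/-- A holomorphic square root `S ↠ TM` of the tangent bundle, where `S` is a holomorphic line
bundle: a holomorphic bundle map that is complex-quadratic (and onto) on each fiber. -/
structure SquareRoot [ContMDiffVectorBundle ω ℂ S 𝓘(ℂ, ℂ)] where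
  sq : ∀ p : M, QuadraticMap ℂ (S p) (TangentSpace 𝓘(ℂ, ℂ) p)
  holomorphic : ContMDiff (𝓘(ℂ, ℂ).prod 𝓘(ℂ, ℂ)) (𝓘(ℂ, ℂ).prod 𝓘(ℂ, ℂ)) ω
    (fun w : TotalSpace ℂ S => (⟨w.1, sq w.1 w.2⟩ : TangentBundle 𝓘(ℂ, ℂ) M))
  surjective : ∀ p, Function.Surjective (sq p)

/-- A spinor representation of `M`: a square root `S` of `TM` and a pair `u, v` of smooth sections
of the complex dual `S^{*1,0}` without common zeros. Smoothness is that of the maps `S → ℂ`. -/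
structure SpinorRepresentation [ContMDiffVectorBundle ω ℂ S 𝓘(ℂ, ℂ)] extends SquareRoot S where
  u : ∀ p : M, S p →ₗ[ℂ] ℂ
  v : ∀ p : M, S p →ₗ[ℂ] ℂ
  smooth_u : ContMDiff (𝓘(ℝ, ℂ).prod 𝓘(ℝ, ℂ)) 𝓘(ℝ, ℂ) ∞ (fun w : TotalSpace ℂ S => u w.1 w.2)
  smooth_v : ContMDiff (𝓘(ℝ, ℂ).prod 𝓘(ℝ, ℂ)) 𝓘(ℝ, ℂ) ∞ (fun w : TotalSpace ℂ S => v w.1 w.2)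
  not_both_zero : ∀ p, ¬ (u p = 0 ∧ v p = 0)

variable {S}

/-- The map `θ : ℂ² → ℂ³` onto the isotropic cone, the affine Veronese map. -/
noncomputable def theta (z₀ z₁ : ℂ) : EuclideanSpace ℂ (Fin 3) :=
  !₂[z₀ ^ 2 - z₁ ^ 2, Complex.I * (z₀ ^ 2 + z₁ ^ 2), 2 * z₀ * z₁]

/-- `(S, u, v)` is the spinor representation corresponding to `ω`: the bundle map
`(u, v) : S → 𝒪(-1) ⊆ ℂP¹ × ℂ²` is a lift of `ω : TM → 𝒪_[Q](-1) ⊆ [Q] × ℂ³` along the quadratic maps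
`S ↠ TM` and `θ : 𝒪(-1) ↠ 𝒪_[Q](-1)`. -/
def SpinorRepresentation.CorrespondsTo [ContMDiffVectorBundle ω ℂ S 𝓘(ℂ, ℂ)]
    (R : SpinorRepresentation S) (W : WeierstrassRepresentation M) : Prop :=
  ∀ (p : M) (w : S p), W.form p (R.sq p w) = theta (R.u p w) (R.v p w)


/-- Complex conjugation `S^{*1,0} → S^{*0,1}`. -/
noncomputable def conjPos {p : M} (ξ : S p →ₗ[ℂ] ℂ) : S p →ₛₗ[starRingEnd ℂ] ℂ where
  toFun w := starRingEnd ℂ (ξ w)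
  map_add' w w' := by rw [map_add, map_add]
  map_smul' c w := by rw [map_smul, smul_eq_mul, map_mul, smul_eq_mul]

/-- The Dolbeault operator `∂̄ : Γ(S^{*1,0}) → Ω^{0,1}(M, S^{*1,0})`. In a local holomorphic frame `e`
of `S` with dual frame `e*`, it is `f e* ↦ ∂̄f ⊗ e*`. An element of `T^{*0,1}_p M ⊗ S^{*1,0}_p` is
an antilinear map `T_p M → S^{*1,0}_p`. -/
noncomputable def dolbeaultPos (ξ : ∀ p : M, S p →ₗ[ℂ] ℂ) (p : M) :
    TangentSpace 𝓘(ℂ, ℂ) p →ₛₗ[starRingEnd ℂ] (S p →ₗ[ℂ] ℂ) where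
  toFun X := delbar (fun x => ξ x (localFrame S p x)) p X • (fiberCoord S p).toLinearMap
  map_add' X Y := by rw [map_add, add_smul]
  map_smul' c X := by rw [LinearMap.map_smulₛₗ, smul_eq_mul, mul_smul]

/-- The conjugate operator `∂ : Γ(S^{*0,1}) → Ω^{1,0}(M, S^{*0,1})`. In a local holomorphic frame `e`
of `S` with dual frame `e*`, it is `f ē* ↦ ∂f ⊗ ē*`. An element of `T^{*1,0}_p M ⊗ S^{*0,1}_p` is
a linear map `T_p M → S^{*0,1}_p`. -/
noncomputable def dolbeaultNeg (ξ : ∀ p : M, S p →ₛₗ[starRingEnd ℂ] ℂ) (p : M) :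
    TangentSpace 𝓘(ℂ, ℂ) p →ₗ[ℂ] (S p →ₛₗ[starRingEnd ℂ] ℂ) where
  toFun X := del (fun x => ξ x (localFrame S p x)) p X • conjPos (fiberCoord S p).toLinearMap
  map_add' X Y := by rw [map_add, add_smul]
  map_smul' c X := by rw [map_smul, smul_eq_mul, mul_smul, RingHom.id_apply]

variable [ContMDiffVectorBundle ω ℂ S 𝓘(ℂ, ℂ)]

namespace SquareRoot

variable (Q : SquareRoot S) (W : WeierstrassRepresentation M)

/-- A square root `√X ∈ S_p` of a tangent vector `X`; only the sign is a choice. -/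
noncomputable def root {p : M} (X : TangentSpace 𝓘(ℂ, ℂ) p) : S p :=
  (Q.surjective p X).choose

lemma sq_root {p : M} (X : TangentSpace 𝓘(ℂ, ℂ) p) : Q.sq p (Q.root X) = X :=
  (Q.surjective p X).choose_spec

lemma sq_eq {p : M} (w : S p) :
    Q.sq p w = fiberCoord S p w ^ 2 • Q.sq p (localFrame S p p) := by
  conv_lhs => rw [← fiberCoord_smul_localFrame p w]
  rw [QuadraticMap.map_smul, pow_two]

lemma sq_localFrame_ne_zero (p : M) : Q.sq p (localFrame S p p) ≠ 0 := by
  intro h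
  obtain ⟨w, hw⟩ := Q.surjective p (show TangentSpace 𝓘(ℂ, ℂ) p from (1 : ℂ))
  rw [Q.sq_eq w, h, smul_zero] at hw
  exact one_ne_zero (α := ℂ) hw.symm

lemma coord_sq_inj {p : M} {a b : ℂ}
    (h : a • Q.sq p (localFrame S p p) = b • Q.sq p (localFrame S p p)) : a = b := by
  have h' : a * (show ℂ from Q.sq p (localFrame S p p)) = b * (show ℂ from Q.sq p (localFrame S p p)) := h
  exact mul_right_cancel₀ (M₀ := ℂ) (Q.sq_localFrame_ne_zero p) h'

lemma coord_root_add {p : M} (X Y : TangentSpace 𝓘(ℂ, ℂ) p) :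
    fiberCoord S p (Q.root (X + Y)) ^ 2 =
      fiberCoord S p (Q.root X) ^ 2 + fiberCoord S p (Q.root Y) ^ 2 := by
  apply Q.coord_sq_inj (p := p)
  rw [add_smul (R := ℂ), ← Q.sq_eq, ← Q.sq_eq, ← Q.sq_eq, sq_root, sq_root, sq_root]

lemma coord_root_smul {p : M} (c : ℂ) (X : TangentSpace 𝓘(ℂ, ℂ) p) :
    fiberCoord S p (Q.root (c • X)) ^ 2 = c * fiberCoord S p (Q.root X) ^ 2 := by
  apply Q.coord_sq_inj (p := p)
  rw [mul_smul (α := ℂ), ← Q.sq_eq, ← Q.sq_eq, sq_root, sq_root]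

/-- The Hermitian metric `√h` on `S` lifted from the Hermitian metric `h` on `TM` with
`h(X, X) = ‖ω(X)‖²`: the Hermitian form with `√h(w, w) = ‖ω(w²)‖`. It is linear in the first
argument and antilinear in the second one. -/
noncomputable def sqrtMetric (p : M) : S p →ₗ[ℂ] S p →ₛₗ[starRingEnd ℂ] ℂ :=
  LinearMap.mk₂'ₛₗ (RingHom.id ℂ) (starRingEnd ℂ)
    (fun w w' => fiberCoord S p w * starRingEnd ℂ (fiberCoord S p w') *
      (‖W.form p (Q.sq p (localFrame S p p))‖ : ℂ))
    (fun w₁ w₂ w' => by rw [map_add]; ring)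
    (fun c w w' => by rw [map_smul, smul_eq_mul, smul_eq_mul, RingHom.id_apply]; ring)
    (fun w w₁ w₂ => by rw [map_add, map_add]; ring)
    (fun c w w' => by rw [map_smul, smul_eq_mul, map_mul, smul_eq_mul]; ring)

lemma sqrtMetric_apply (p : M) (w w' : S p) : Q.sqrtMetric W p w w' =
    fiberCoord S p w * starRingEnd ℂ (fiberCoord S p w') *
      (‖W.form p (Q.sq p (localFrame S p p))‖ : ℂ) := rfl

lemma sqrtMetric_self (p : M) (w : S p) :
    Q.sqrtMetric W p w w = (‖W.form p (Q.sq p w)‖ : ℂ) := by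
  rw [sqrtMetric_apply, Q.sq_eq w, map_smul, norm_smul, Complex.mul_conj, Complex.normSq_eq_norm_sq,
    norm_pow]
  push_cast
  ring

lemma sqrtMetric_conj_symm (p : M) (w w' : S p) :
    starRingEnd ℂ (Q.sqrtMetric W p w w') = Q.sqrtMetric W p w' w := by
  rw [sqrtMetric_apply, sqrtMetric_apply, map_mul, map_mul, Complex.conj_conj, Complex.conj_ofReal]
  ring

lemma norm_form_ne_zero (p : M) : (‖W.form p (Q.sq p (localFrame S p p))‖ : ℂ) ≠ 0 := by
  rw [Complex.ofReal_ne_zero, norm_ne_zero_iff]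
  exact W.form_ne_zero p (Q.sq_localFrame_ne_zero p)

lemma coord_root_sq {p : M} (w : S p) :
    fiberCoord S p (Q.root (Q.sq p w)) ^ 2 = fiberCoord S p w ^ 2 := by
  apply Q.coord_sq_inj (p := p)
  rw [← Q.sq_eq, ← Q.sq_eq, sq_root]

lemma neg_mul_sqrtMetric {p : M} (ξ : S p →ₛₗ[starRingEnd ℂ] ℂ) (r w : S p) :
    ξ r * Q.sqrtMetric W p w r = starRingEnd ℂ (fiberCoord S p r ^ 2) *
      (ξ (localFrame S p p) * (fiberCoord S p w *
        (‖W.form p (Q.sq p (localFrame S p p))‖ : ℂ))) := by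
  conv_lhs => rw [← fiberCoord_smul_localFrame p r]
  rw [LinearMap.map_smulₛₗ, fiberCoord_smul_localFrame, sqrtMetric_apply, smul_eq_mul, map_pow]
  ring

lemma pos_mul_sqrtMetric {p : M} (ξ : S p →ₗ[ℂ] ℂ) (r w : S p) :
    ξ r * Q.sqrtMetric W p r w = fiberCoord S p r ^ 2 *
      (ξ (localFrame S p p) * (starRingEnd ℂ (fiberCoord S p w) *
        (‖W.form p (Q.sq p (localFrame S p p))‖ : ℂ))) := by
  conv_lhs => rw [← fiberCoord_smul_localFrame p r]
  rw [LinearMap.map_smul, fiberCoord_smul_localFrame, sqrtMetric_apply, smul_eq_mul]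
  ring

/-- The linear map underlying `tauNeg`. -/
noncomputable def tauNegHom (p : M) : (S p →ₛₗ[starRingEnd ℂ] ℂ) →ₗ[ℂ]
    (TangentSpace 𝓘(ℂ, ℂ) p →ₛₗ[starRingEnd ℂ] (S p →ₗ[ℂ] ℂ)) :=
  LinearMap.mk₂'ₛₗ (RingHom.id ℂ) (starRingEnd ℂ)
    (fun ξ X => ξ (Q.root X) • (Q.sqrtMetric W p).flip (Q.root X))
    (fun ξ ξ' X => by rw [LinearMap.add_apply, add_smul])
    (fun c ξ X => by rw [LinearMap.smul_apply, smul_assoc, RingHom.id_apply])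
    (fun ξ X Y => by
      refine LinearMap.ext fun w => ?_
      simp only [LinearMap.smul_apply, LinearMap.add_apply, LinearMap.flip_apply, smul_eq_mul]
      rw [neg_mul_sqrtMetric, neg_mul_sqrtMetric, neg_mul_sqrtMetric, coord_root_add, map_add,
        add_mul])
    (fun c ξ X => by
      refine LinearMap.ext fun w => ?_
      simp only [LinearMap.smul_apply, LinearMap.flip_apply, smul_eq_mul]
      rw [neg_mul_sqrtMetric, neg_mul_sqrtMetric, coord_root_smul, map_mul, mul_assoc])

/-- The linear map underlying `tauPos`. -/
noncomputable def tauPosHom (p : M) : (S p →ₗ[ℂ] ℂ) →ₗ[ℂ]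
    (TangentSpace 𝓘(ℂ, ℂ) p →ₗ[ℂ] (S p →ₛₗ[starRingEnd ℂ] ℂ)) :=
  LinearMap.mk₂'ₛₗ (RingHom.id ℂ) (RingHom.id ℂ)
    (fun ξ X => ξ (Q.root X) • Q.sqrtMetric W p (Q.root X))
    (fun ξ ξ' X => by rw [LinearMap.add_apply, add_smul])
    (fun c ξ X => by rw [LinearMap.smul_apply, smul_assoc, RingHom.id_apply])
    (fun ξ X Y => by
      refine LinearMap.ext fun w => ?_
      simp only [LinearMap.smul_apply, LinearMap.add_apply, smul_eq_mul]
      rw [pos_mul_sqrtMetric, pos_mul_sqrtMetric, pos_mul_sqrtMetric, coord_root_add, add_mul])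
    (fun c ξ X => by
      refine LinearMap.ext fun w => ?_
      simp only [LinearMap.smul_apply, smul_eq_mul, RingHom.id_apply]
      rw [pos_mul_sqrtMetric, pos_mul_sqrtMetric, coord_root_smul, mul_assoc])

/-- `τ_{0,1}` does not depend on the choice of the square roots of tangent vectors. -/
lemma tauNegHom_apply_sq (p : M) (ξ : S p →ₛₗ[starRingEnd ℂ] ℂ) (s w : S p) :
    Q.tauNegHom W p ξ (Q.sq p s) w = ξ s * Q.sqrtMetric W p w s := by
  change ξ (Q.root (Q.sq p s)) * Q.sqrtMetric W p w (Q.root (Q.sq p s)) = _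
  rw [neg_mul_sqrtMetric, neg_mul_sqrtMetric, coord_root_sq]

/-- `τ_{1,0}` does not depend on the choice of the square roots of tangent vectors. -/
lemma tauPosHom_apply_sq (p : M) (ξ : S p →ₗ[ℂ] ℂ) (s w : S p) :
    Q.tauPosHom W p ξ (Q.sq p s) w = ξ s * Q.sqrtMetric W p s w := by
  change ξ (Q.root (Q.sq p s)) * Q.sqrtMetric W p (Q.root (Q.sq p s)) w = _
  rw [pos_mul_sqrtMetric, pos_mul_sqrtMetric, coord_root_sq]

lemma tauNegHom_bijective (p : M) : Function.Bijective (Q.tauNegHom W p) := by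
  have hN := Q.norm_form_ne_zero W p
  constructor
  · intro ξ ξ' h
    refine LinearMap.ext fun s => ?_
    have h1 : ξ (localFrame S p p) = ξ' (localFrame S p p) := by
      have h2 := congrArg (fun η => η (Q.sq p (localFrame S p p)) (localFrame S p p)) h
      simp only [tauNegHom_apply_sq, sqrtMetric_apply, fiberCoord_localFrame, map_one, one_mul] at h2
      exact mul_right_cancel₀ hN h2
    rw [← fiberCoord_smul_localFrame p s, LinearMap.map_smulₛₗ, LinearMap.map_smulₛₗ, h1]
  · intro η
    refine ⟨(η (Q.sq p (localFrame S p p)) (localFrame S p p) /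
      (‖W.form p (Q.sq p (localFrame S p p))‖ : ℂ)) • conjPos (fiberCoord S p).toLinearMap, ?_⟩
    refine LinearMap.ext fun X => LinearMap.ext fun w => ?_
    obtain ⟨s, rfl⟩ := Q.surjective p X
    rw [tauNegHom_apply_sq, neg_mul_sqrtMetric, Q.sq_eq s, LinearMap.map_smulₛₗ,
      LinearMap.smul_apply, LinearMap.smul_apply]
    conv_rhs => rw [← fiberCoord_smul_localFrame p w, LinearMap.map_smul]
    have h3 : conjPos (fiberCoord S p).toLinearMap (localFrame S p p) = 1 := by
      change starRingEnd ℂ (fiberCoord S p (localFrame S p p)) = 1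
      rw [fiberCoord_localFrame, map_one]
    rw [h3]
    simp only [smul_eq_mul]
    field_simp

lemma tauPosHom_bijective (p : M) : Function.Bijective (Q.tauPosHom W p) := by
  have hN := Q.norm_form_ne_zero W p
  constructor
  · intro ξ ξ' h
    refine LinearMap.ext fun s => ?_
    have h1 : ξ (localFrame S p p) = ξ' (localFrame S p p) := by
      have h2 := congrArg (fun η => η (Q.sq p (localFrame S p p)) (localFrame S p p)) h
      simp only [tauPosHom_apply_sq, sqrtMetric_apply, fiberCoord_localFrame, map_one, one_mul] at h2
      exact mul_right_cancel₀ hN h2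
    rw [← fiberCoord_smul_localFrame p s, LinearMap.map_smul, LinearMap.map_smul, h1]
  · intro η
    refine ⟨(η (Q.sq p (localFrame S p p)) (localFrame S p p) /
      (‖W.form p (Q.sq p (localFrame S p p))‖ : ℂ)) • (fiberCoord S p).toLinearMap, ?_⟩
    refine LinearMap.ext fun X => LinearMap.ext fun w => ?_
    obtain ⟨s, rfl⟩ := Q.surjective p X
    rw [tauPosHom_apply_sq, pos_mul_sqrtMetric, Q.sq_eq s, LinearMap.map_smul,
      LinearMap.smul_apply, LinearMap.smul_apply]
    conv_rhs => rw [← fiberCoord_smul_localFrame p w, LinearMap.map_smulₛₗ]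
    have h3 : (fiberCoord S p).toLinearMap (localFrame S p p) = 1 := fiberCoord_localFrame p
    rw [h3]
    simp only [smul_eq_mul]
    field_simp

/-- The isomorphism `τ_{0,1} : S^{*0,1} ≅ S^{*0,1} ⊗ S^{*1,0} ⊗ S^{*0,1} ≅ T^{*0,1}M ⊗ S^{*1,0}` given by
multiplication by `√h`, that is `(X, w) ↦ ξ(√X) √h(w, √X)`. -/
noncomputable def tauNeg (p : M) : (S p →ₛₗ[starRingEnd ℂ] ℂ) ≃ₗ[ℂ]
    (TangentSpace 𝓘(ℂ, ℂ) p →ₛₗ[starRingEnd ℂ] (S p →ₗ[ℂ] ℂ)) :=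
  LinearEquiv.ofBijective (Q.tauNegHom W p) (Q.tauNegHom_bijective W p)

/-- The isomorphism `τ_{1,0} : S^{*1,0} ≅ S^{*1,0} ⊗ S^{*1,0} ⊗ S^{*0,1} ≅ T^{*1,0}M ⊗ S^{*0,1}` given by
multiplication by `√h`, that is `(X, w) ↦ ξ(√X) √h(√X, w)`. -/
noncomputable def tauPos (p : M) : (S p →ₗ[ℂ] ℂ) ≃ₗ[ℂ]
    (TangentSpace 𝓘(ℂ, ℂ) p →ₗ[ℂ] (S p →ₛₗ[starRingEnd ℂ] ℂ)) :=
  LinearEquiv.ofBijective (Q.tauPosHom W p) (Q.tauPosHom_bijective W p)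

/-- The Dirac operator on positive spinors, `D = τ_{0,1}⁻¹ ∘ ∂̄ : Γ(S^{*1,0}) → Γ(S^{*0,1})`. -/
noncomputable def diracPos (ξ : ∀ p : M, S p →ₗ[ℂ] ℂ) (p : M) : S p →ₛₗ[starRingEnd ℂ] ℂ :=
  (Q.tauNeg W p).symm (dolbeaultPos ξ p)

/-- The Dirac operator on negative spinors, `D = τ_{1,0}⁻¹ ∘ ∂ : Γ(S^{*0,1}) → Γ(S^{*1,0})`. -/
noncomputable def diracNeg (ξ : ∀ p : M, S p →ₛₗ[starRingEnd ℂ] ℂ) (p : M) : S p →ₗ[ℂ] ℂ :=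
  (Q.tauPos W p).symm (dolbeaultNeg ξ p)

end SquareRoot

end Spinors

end SpinorSurface

/-! Both conditions are pointwise, so fix `p`, the chart `z` at `p` and the holomorphic frame `e` of
`S` near `p`. There `e² = q ∂_z` with `q` holomorphic and nonvanishing near `p`
(`SquareRoot.exists_holomorphic_coeff`), and `u = a e*`, `v = b e*` with `a`, `b` smooth.
Correspondence gives `ω = G dz` with `G = q⁻¹ θ(a, b)`, hence `dω = 2i G_z̄ dx ∧ dy`
(`extDeriv_smul_dz`): integrability says that all three components of `G_z̄` are real.

Since `q⁻¹` is holomorphic, `G_z̄` is `q⁻¹` times `(2(a a_z̄ - b b_z̄), 2i(a a_z̄ + b b_z̄), 2(a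
b_z̄ + b a_z̄))` (`fderiv_smul_theta_dbar`). On the frame, with `N = ‖ω(e²)‖`, the Dirac operator is
`Du(e) = q̄ a_z̄ / N` and `Dū(e) = q conj(a_z̄) / N`, and likewise for `v` and `b`
(`diracPos_localFrame`, `diracNeg_localFrame`).

Put `α = a a_z̄ q̄`, `β = b b_z̄ q̄` and `γ = (a b_z̄ + b a_z̄) q̄`. The first two components of
`G_z̄` are real exactly when `β = -ᾱ`, which is the first Dirac identity; the third is real exactly
when `γ = γ̄`, which is the second (`integrability_algebra`). -/

namespace SpinorSurface

open Filter Topology ComplexConjugate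

/-! ### Complex derivatives as real derivatives -/

section Scalars

variable {E F M N : Type*} [NormedAddCommGroup E] [NormedSpace ℝ E] [NormedSpace ℂ E]
  [IsScalarTower ℝ ℂ E]
  [NormedAddCommGroup F] [NormedSpace ℝ F] [NormedSpace ℂ F] [IsScalarTower ℝ ℂ F]
  [TopologicalSpace M] [ChartedSpace E M] [TopologicalSpace N] [ChartedSpace F N]

/-- A complex manifold derivative, seen as a real-linear map, is the real manifold derivative. -/
lemma mfderiv_real_apply {f : M → N} {x : M} (h : MDifferentiableAt 𝓘(ℂ, E) 𝓘(ℂ, F) f x)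
    (X : E) :
    (mfderiv 𝓘(ℝ, E) 𝓘(ℝ, F) f x : E → F) X = (mfderiv 𝓘(ℂ, E) 𝓘(ℂ, F) f x : E → F) X := by
  have h0 := h.hasMFDerivAt
  let L : E →L[ℂ] F := mfderiv 𝓘(ℂ, E) 𝓘(ℂ, F) f x
  have h2 : HasFDerivWithinAt (writtenInExtChartAt 𝓘(ℂ, E) 𝓘(ℂ, F) x f : E → F) L
    (Set.range 𝓘(ℂ, E)) (extChartAt 𝓘(ℂ, E) x x) := h0.2
  -- The charts and models over `ℝ` and `ℂ` are the same maps, so only the scalars of the derivative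
  -- in charts change.
  have h1 : HasMFDerivAt 𝓘(ℝ, E) 𝓘(ℝ, F) f x (L.restrictScalars ℝ) :=
    ⟨h0.1, h2.restrictScalars ℝ⟩
  rw [h1.mfderiv]
  rfl

end Scalars

/-! ### Regularity of the local frame and of spinor coefficients -/

section Frames

variable {M : Type*} [TopologicalSpace M] [ChartedSpace ℂ M]
  {S : M → Type*} [TopologicalSpace (TotalSpace ℂ S)] [∀ p, AddCommGroup (S p)]
  [∀ p, TopologicalSpace (S p)] [FiberBundle ℂ S]

/-- In the trivialization that defines it, the frame is the constant `1`. The base field is left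
free because the frame serves both as a holomorphic section (for `e²`) and as a real smooth one (for
`u` and `v`). -/
lemma contMDiffAt_localFrame {𝕜 : Type*} [NontriviallyNormedField 𝕜] [NormedSpace 𝕜 ℂ]
    {n : WithTop ℕ∞} (p : M) :
    ContMDiffAt 𝓘(𝕜, ℂ) (𝓘(𝕜, ℂ).prod 𝓘(𝕜, ℂ)) n
      (fun x => (⟨x, localFrame S p x⟩ : TotalSpace ℂ S)) p := by
  rw [Bundle.contMDiffAt_totalSpace]
  refine ⟨contMDiffAt_id, ?_⟩
  refine (contMDiffAt_const (c := (1 : ℂ))).congr_of_eventuallyEq ?_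
  filter_upwards [(trivializationAt ℂ S p).open_baseSet.mem_nhds
    (mem_baseSet_trivializationAt ℂ S p)] with x hx
  simp only [localFrame]
  rw [(trivializationAt ℂ S p).apply_mk_symm hx]

/-- The coefficient of a smooth section of the dual bundle in the local frame is smooth. -/
lemma contMDiffAt_coeff [∀ p, Module ℂ (S p)] {ξ : ∀ p : M, S p →ₗ[ℂ] ℂ}
    (h : ContMDiff (𝓘(ℝ, ℂ).prod 𝓘(ℝ, ℂ)) 𝓘(ℝ, ℂ) ∞ (fun w : TotalSpace ℂ S => ξ w.1 w.2))
    (p : M) : ContMDiffAt 𝓘(ℝ, ℂ) 𝓘(ℝ, ℂ) ∞ (fun x => ξ x (localFrame S p x)) p :=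
  ContMDiffAt.comp p (h ⟨p, localFrame S p p⟩) (contMDiffAt_localFrame p)

end Frames

/-! ### Differentials read in the preferred chart -/

section Coordinates

variable {M : Type*} [TopologicalSpace M] [ChartedSpace ℂ M]

lemma differentiableAt_comp_chart_symm {𝕜 : Type*} [NontriviallyNormedField 𝕜] [NormedSpace 𝕜 ℂ]
    {f : M → ℂ} {p : M} (h : MDifferentiableAt 𝓘(𝕜, ℂ) 𝓘(𝕜, ℂ) f p) :
    DifferentiableAt 𝕜 (f ∘ (extChartAt 𝓘(𝕜, ℂ) p).symm) (extChartAt 𝓘(𝕜, ℂ) p p) := by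
  have h1 := ((mdifferentiableAt_iff f p).1 h).2
  rw [show Set.range 𝓘(𝕜, ℂ) = Set.univ from Set.range_id, differentiableWithinAt_univ] at h1
  exact h1

lemma realDiff_eq_fderiv {f : M → ℂ} {p : M} (h : MDifferentiableAt 𝓘(ℝ, ℂ) 𝓘(ℝ, ℂ) f p)
    (X : ℂ) :
    realDiff f p X =
      fderiv ℝ (f ∘ (extChartAt 𝓘(ℝ, ℂ) p).symm) (extChartAt 𝓘(ℝ, ℂ) p p) X := by
  let L : ℂ →L[ℝ] ℂ := mfderiv 𝓘(ℝ, ℂ) 𝓘(ℝ, ℂ) f p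
  have h0 : HasFDerivWithinAt (writtenInExtChartAt 𝓘(ℝ, ℂ) 𝓘(ℝ, ℂ) p f : ℂ → ℂ)
    L (Set.range 𝓘(ℝ, ℂ)) (extChartAt 𝓘(ℝ, ℂ) p p) := h.hasMFDerivAt.2
  rw [show Set.range 𝓘(ℝ, ℂ) = Set.univ from Set.range_id, hasFDerivWithinAt_univ] at h0
  exact (congrArg (fun L : ℂ →L[ℝ] ℂ => L X) (HasFDerivAt.fderiv h0)).symm

end Coordinates

section Chart

variable {M : Type*} [TopologicalSpace M] [ChartedSpace ℂ M] [IsManifold 𝓘(ℂ, ℂ) ω M]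

/-- The preferred chart at `p` is what identifies `T_p M` with `ℂ`, so its complex derivative at `p`
is the identity; the real derivative is the same map. -/
lemma mfderiv_chart_self_real (p : M) (X : ℂ) :
    (mfderiv 𝓘(ℝ, ℂ) 𝓘(ℝ, ℂ) (extChartAt 𝓘(ℝ, ℂ) p) p : ℂ → ℂ) X = X := by
  have h := mfderiv_real_apply (mdifferentiableAt_extChartAt (I := 𝓘(ℂ, ℂ))
    (mem_chart_source ℂ p)) X
  refine h.trans ?_
  rw [mfderiv_extChartAt_self]
  rfl

lemma mdifferentiableAt_chart_symm (p : M) {z : ℂ} (hz : z ∈ (extChartAt 𝓘(ℂ, ℂ) p).target) :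
    MDifferentiableAt 𝓘(ℂ, ℂ) 𝓘(ℂ, ℂ) (extChartAt 𝓘(ℂ, ℂ) p).symm z := by
  have h := mdifferentiableWithinAt_extChartAt_symm hz
  rwa [show Set.range 𝓘(ℂ, ℂ) = Set.univ from Set.range_id, mdifferentiableWithinAt_univ] at h

end Chart

/-! ### Cauchy-Riemann calculus on the plane -/

section Plane

/-- Twice the Wirtinger derivative `∂f/∂z̄` of a function on the plane. -/
noncomputable def dbar (f : ℂ → ℂ) (z : ℂ) : ℂ :=
  fderiv ℝ f z 1 + Complex.I * fderiv ℝ f z Complex.I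

variable {f g : ℂ → ℂ} {z : ℂ}

lemma dbar_add (hf : DifferentiableAt ℝ f z) (hg : DifferentiableAt ℝ g z) :
    dbar (fun w => f w + g w) z = dbar f z + dbar g z := by
  simp only [dbar, fderiv_fun_add hf hg, add_apply]
  ring

lemma dbar_sub (hf : DifferentiableAt ℝ f z) (hg : DifferentiableAt ℝ g z) :
    dbar (fun w => f w - g w) z = dbar f z - dbar g z := by
  simp only [dbar, fderiv_fun_sub hf hg, sub_apply]
  ring

lemma dbar_mul (hf : DifferentiableAt ℝ f z) (hg : DifferentiableAt ℝ g z) :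
    dbar (fun w => f w * g w) z = f z * dbar g z + g z * dbar f z := by
  simp only [dbar, fderiv_fun_mul hf hg, add_apply,
    smul_apply, smul_eq_mul]
  ring

/-- Complex linearity of the derivative turns `f'(I)` into `I f'(1)`, and `I² = -1` cancels the two
terms. -/
lemma dbar_eq_zero (hf : DifferentiableAt ℂ f z) : dbar f z = 0 := by
  have h : fderiv ℝ f z = (fderiv ℂ f z).restrictScalars ℝ := hf.fderiv_restrictScalars ℝ
  have hI : fderiv ℂ f z Complex.I = Complex.I * fderiv ℂ f z 1 := by
    rw [← smul_eq_mul, ← map_smul, smul_eq_mul, mul_one]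
  rw [dbar, h, ContinuousLinearMap.coe_restrictScalars', hI, ← mul_assoc, Complex.I_mul_I]
  ring

/-- The exterior derivative of the `(1,0)`-form `G dz` on the plane. -/
lemma extDeriv_smul_dz {F : Type*} [NormedAddCommGroup F] [NormedSpace ℂ F]
    {G : ℂ → F} {α : ℂ → ℂ →L[ℝ] F} (hG : DifferentiableAt ℝ G z)
    (hα : ∀ᶠ w in 𝓝 z, ∀ c, α w c = c • G w) (X : Fin 2 → ℂ) :
    extDeriv (fun w => ContinuousAlternatingMap.ofSubsingleton ℝ ℂ F (0 : Fin 1) (α w)) z X =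
      ((((X 0).re * (X 1).im - (X 1).re * (X 0).im : ℝ) : ℂ) * Complex.I) •
        (fderiv ℝ G z 1 + Complex.I • fderiv ℝ G z Complex.I) := by
  -- Near `z` the form is a fixed continuous linear image of `G`, so it inherits the
  -- differentiability of `G`.
  let L : F →L[ℝ] ℂ →L[ℝ] F := (ContinuousLinearMap.lsmul ℝ ℂ : ℂ →L[ℝ] F →L[ℝ] F).flip
  have hL : α =ᶠ[𝓝 z] fun w => L (G w) := by
    filter_upwards [hα] with w hw
    ext c
    simp [L, hw]
  have hd : DifferentiableAt ℝ α z :=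
    (L.differentiableAt.comp z hG).congr_of_eventuallyEq hL
  have hd' : DifferentiableAt ℝ
      (fun w => ContinuousAlternatingMap.ofSubsingleton ℝ ℂ F (0 : Fin 1) (α w)) z :=
    (ContinuousAlternatingMap.ofSubsingletonLIE (𝕜 := ℝ) (E := ℂ) (F := F)
      (0 : Fin 1)).toContinuousLinearEquiv.differentiableAt.comp z hd
  have key : ∀ c Y : ℂ, fderiv ℝ (fun w => α w c) z Y = c • fderiv ℝ G z Y := by
    intro c Y
    have h1 : (fun w => α w c) =ᶠ[𝓝 z] fun w => c • G w := by
      filter_upwards [hα] with w hw using hw c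
    rw [h1.fderiv_eq, fderiv_fun_const_smul hG]
    rfl
  have hlin : ∀ Y : ℂ, fderiv ℝ G z Y =
      (Y.re : ℂ) • fderiv ℝ G z 1 + (Y.im : ℂ) • fderiv ℝ G z Complex.I := by
    intro Y
    conv_lhs => rw [← Complex.re_add_im Y]
    rw [map_add, ← mul_one (Y.re : ℂ), ← Complex.real_smul, ← Complex.real_smul, map_smul,
      map_smul]
    simp
  -- On two vectors the alternating sum is `c₁ • G'(X 0) - c₀ • G'(X 1)`, where `c_j = X j` is the
  -- value of `dz`.
  rw [extDeriv_apply hd', Fin.sum_univ_two]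
  simp only [ContinuousAlternatingMap.ofSubsingleton_apply_apply, Fin.val_zero, pow_zero, one_smul,
    Fin.val_one, pow_one, neg_smul, key]
  have e0 : (0 : Fin 2).removeNth X 0 = X 1 := rfl
  have e1 : (1 : Fin 2).removeNth X 0 = X 0 := rfl
  rw [e0, e1, hlin (X 0), hlin (X 1)]
  simp only [smul_add, smul_smul, ← sub_eq_add_neg]
  have hX0 := Complex.re_add_im (X 0)
  have hX1 := Complex.re_add_im (X 1)
  set A := fderiv ℝ G z 1
  set B := fderiv ℝ G z Complex.I
  -- Collecting the terms in `G_x` and `G_y`, both coefficients are multiples of the area `dx ∧ dy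
  -- (X 0, X 1)`, by `I` and by `I * I` respectively.
  have c1 : X 1 * ((X 0).re : ℂ) - X 0 * ((X 1).re : ℂ) =
      (((X 0).re * (X 1).im - (X 1).re * (X 0).im : ℝ) : ℂ) * Complex.I := by
    push_cast; linear_combination (-((X 0).re : ℂ)) * hX1 + ((X 1).re : ℂ) * hX0
  have c2 : X 1 * ((X 0).im : ℂ) - X 0 * ((X 1).im : ℂ) =
      (((X 0).re * (X 1).im - (X 1).re * (X 0).im : ℝ) : ℂ) * Complex.I * Complex.I := by
    push_cast
    linear_combination (-((X 0).im : ℂ)) * hX1 + ((X 1).im : ℂ) * hX0 -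
      (((X 0).re : ℂ) * (X 1).im - (X 1).re * (X 0).im) * Complex.I_sq
  rw [← c2, ← c1, sub_smul, sub_smul]
  abel

end Plane

/-! ### Pointwise algebra behind the two identities -/

section Algebra

/-- The pointwise content of the equivalence: `θ(u,v)_z̄ / q` is real in each component exactly when
the two quadratic identities hold. -/
lemma integrability_algebra (a b A B q : ℂ) (hq : q ≠ 0) (N : ℝ) (hN : (N : ℂ) ≠ 0) :
    ((Complex.I * (q⁻¹ * (2 * a * A - 2 * b * B))).re = 0 ∧
      (Complex.I * (q⁻¹ * (Complex.I * (2 * a * A + 2 * b * B)))).re = 0 ∧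
      (Complex.I * (q⁻¹ * (2 * (a * B + b * A)))).re = 0) ↔
    (b * (conj q * (B / 2) / N) = -(q * conj (A / 2) / N * conj a) ∧
      a * (conj q * (B / 2) / N) + b * (conj q * (A / 2) / N) =
        q * conj (B / 2) / N * conj a + q * conj (A / 2) / N * conj b) := by
  set α := a * A * conj q with hα
  set β := b * B * conj q with hβ
  set γ := (a * B + b * A) * conj q with hγ
  -- Writing `q⁻¹ = q̄ / |q|²` extracts a nonzero real factor, which does not affect whether a real
  -- part vanishes.
  have hr : 2 * (Complex.normSq q)⁻¹ ≠ 0 := by simpa using hq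
  have e1 : Complex.I * (q⁻¹ * (2 * a * A - 2 * b * B)) =
      ((2 * (Complex.normSq q)⁻¹ : ℝ) : ℂ) * (Complex.I * (α - β)) := by
    rw [Complex.inv_def]; push_cast; ring
  have e2 : Complex.I * (q⁻¹ * (Complex.I * (2 * a * A + 2 * b * B))) =
      ((2 * (Complex.normSq q)⁻¹ : ℝ) : ℂ) * (-(α + β)) := by
    rw [Complex.inv_def]; push_cast
    linear_combination (2 * conj q * (Complex.normSq q : ℂ)⁻¹ * (a * A + b * B)) * Complex.I_sq
  have e3 : Complex.I * (q⁻¹ * (2 * (a * B + b * A))) =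
      ((2 * (Complex.normSq q)⁻¹ : ℝ) : ℂ) * (Complex.I * γ) := by
    rw [Complex.inv_def]; push_cast; ring
  -- The two sides are `β / (2N)` and `-conj α / (2N)`; it matters here that `conj` does not act on
  -- `N`.
  have f1 : b * (conj q * (B / 2) / N) = -(q * conj (A / 2) / N * conj a) ↔ β = -conj α := by
    simp only [hα, hβ, map_mul, map_div₀, Complex.conj_conj, map_ofNat]
    field_simp
  have f2 : a * (conj q * (B / 2) / N) + b * (conj q * (A / 2) / N) =
      q * conj (B / 2) / N * conj a + q * conj (A / 2) / N * conj b ↔ γ = conj γ := by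
    simp only [hγ, map_mul, map_add, map_div₀, Complex.conj_conj, map_ofNat]
    field_simp
  rw [e1, e2, e3, f1, f2, Complex.re_ofReal_mul, Complex.re_ofReal_mul, Complex.re_ofReal_mul,
    mul_eq_zero_iff_left hr, mul_eq_zero_iff_left hr, mul_eq_zero_iff_left hr]
  -- What remains: `Im α = Im β` and `Re (α + β) = 0` together mean `β = -conj α`, while `Im γ = 0`
  -- means `γ = conj γ`.
  simp only [Complex.ext_iff, Complex.mul_re, Complex.I_re, Complex.I_im, Complex.sub_re,
    Complex.sub_im, Complex.neg_re, Complex.neg_im, Complex.add_re, Complex.conj_re,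
    Complex.conj_im]
  constructor
  · rintro ⟨h1, h2, h3⟩
    exact ⟨⟨by linarith, by linarith⟩, trivial, by linarith⟩
  · rintro ⟨⟨h1, h2⟩, -, h3⟩
    exact ⟨by linarith, by linarith, by linarith⟩

end Algebra

/-! ### The square of the frame as a holomorphic vector field -/

section Spinors

variable {M : Type*} [TopologicalSpace M] [ChartedSpace ℂ M] [IsManifold 𝓘(ℂ, ℂ) ω M]
  {S : M → Type*} [TopologicalSpace (TotalSpace ℂ S)] [∀ p, AddCommGroup (S p)]
  [∀ p, Module ℂ (S p)] [∀ p, TopologicalSpace (S p)] [FiberBundle ℂ S] [VectorBundle ℂ ℂ S]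
  [ContMDiffVectorBundle ω ℂ S 𝓘(ℂ, ℂ)]

/-- In a chart, the square of the local frame is a holomorphic vector field. -/
lemma SquareRoot.exists_holomorphic_coeff (Q : SquareRoot S) (p : M) :
    ∃ q : ℂ → ℂ, DifferentiableAt ℂ q (extChartAt 𝓘(ℝ, ℂ) p p) ∧
      q (extChartAt 𝓘(ℝ, ℂ) p p) = Q.sq p (localFrame S p p) ∧
      ∀ᶠ z in 𝓝 (extChartAt 𝓘(ℝ, ℂ) p p), ∀ c : ℂ,
        (mfderiv 𝓘(ℝ, ℂ) 𝓘(ℝ, ℂ) (extChartAt 𝓘(ℝ, ℂ) p).symm z : ℂ → ℂ) (c * q z) =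
          c • (Q.sq ((extChartAt 𝓘(ℝ, ℂ) p).symm z)
            (localFrame S p ((extChartAt 𝓘(ℝ, ℂ) p).symm z)) : ℂ) := by
  let V : M → TangentBundle 𝓘(ℂ, ℂ) M := fun x => ⟨x, Q.sq x (localFrame S p x)⟩
  have hV : ContMDiffAt 𝓘(ℂ, ℂ) (𝓘(ℂ, ℂ).prod 𝓘(ℂ, ℂ)) ω V p :=
    ContMDiffAt.comp p (Q.holomorphic ⟨p, localFrame S p p⟩) (contMDiffAt_localFrame p)
  -- The coordinate of `e²` in the tangent trivialization at `p`; it is holomorphic because both the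
  -- frame and the squaring map are.
  let f : M → ℂ := fun x => (trivializationAt ℂ (TangentSpace 𝓘(ℂ, ℂ)) p (V x)).2
  have hf : ContMDiffAt 𝓘(ℂ, ℂ) 𝓘(ℂ, ℂ) ω f p := (Bundle.contMDiffAt_totalSpace.1 hV).2
  have hfx : ∀ x ∈ (chartAt ℂ p).source,
      f x = (mfderiv 𝓘(ℂ, ℂ) 𝓘(ℂ, ℂ) (extChartAt 𝓘(ℂ, ℂ) p) x : ℂ → ℂ)
        (Q.sq x (localFrame S p x)) := by
    intro x hx
    refine Eq.trans ?_ (congrArg (fun L : ℂ →L[ℂ] ℂ => L (Q.sq x (localFrame S p x)))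
      (TangentBundle.continuousLinearMapAt_trivializationAt (I := 𝓘(ℂ, ℂ)) hx))
    exact (congrFun (Trivialization.coe_linearMapAt_of_mem (R := ℂ)
      (trivializationAt ℂ (TangentSpace 𝓘(ℂ, ℂ)) p) hx) (Q.sq x (localFrame S p x))).symm
  refine ⟨f ∘ (extChartAt 𝓘(ℂ, ℂ) p).symm,
    differentiableAt_comp_chart_symm (hf.mdifferentiableAt (by simp)), ?_, ?_⟩
  · change f ((extChartAt 𝓘(ℂ, ℂ) p).symm (extChartAt 𝓘(ℂ, ℂ) p p)) = _
    rw [extChartAt_to_inv, hfx p (mem_chart_source ℂ p), mfderiv_extChartAt_self]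
    rfl
  · filter_upwards [extChartAt_target_mem_nhds (I := 𝓘(ℂ, ℂ)) p] with z hz c
    have hx : (extChartAt 𝓘(ℂ, ℂ) p).symm z ∈ (chartAt ℂ p).source := by
      rw [← extChartAt_source 𝓘(ℂ, ℂ)]
      exact (extChartAt 𝓘(ℂ, ℂ) p).map_target hz
    refine (mfderiv_real_apply (mdifferentiableAt_chart_symm p hz) _).trans ?_
    set x := (extChartAt 𝓘(ℂ, ℂ) p).symm z with hxdef
    have hzx : extChartAt 𝓘(ℂ, ℂ) p x = z := (extChartAt 𝓘(ℂ, ℂ) p).right_inv hz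
    -- The derivative of the inverse chart undoes that of the chart, and so carries the coordinate
    -- of `e²` back to `e²`.
    have hcomp := mfderivWithin_extChartAt_symm_comp_mfderiv_extChartAt' (I := 𝓘(ℂ, ℂ))
      (x := p) (y := x) ((extChartAt 𝓘(ℂ, ℂ) p).map_target hz)
    rw [hzx, show Set.range 𝓘(ℂ, ℂ) = Set.univ from Set.range_id, mfderivWithin_univ] at hcomp
    let L : ℂ →L[ℂ] ℂ := mfderiv 𝓘(ℂ, ℂ) 𝓘(ℂ, ℂ) (extChartAt 𝓘(ℂ, ℂ) p).symm z
    change L (c * f x) = _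
    rw [← smul_eq_mul, map_smul, hfx x hx]
    exact congrArg (c • ·)
      (congrArg (fun L : ℂ →L[ℂ] ℂ => L (Q.sq x (localFrame S p x))) hcomp)

end Spinors

/-! ### Form and spinors in coordinates -/

section Spinors

variable {M : Type*} [TopologicalSpace M] [ChartedSpace ℂ M]
  {S : M → Type*} [TopologicalSpace (TotalSpace ℂ S)] [∀ p, AddCommGroup (S p)]
  [∀ p, Module ℂ (S p)] [∀ p, TopologicalSpace (S p)] [FiberBundle ℂ S]

lemma fderiv_euclidean_apply {G : ℂ → EuclideanSpace ℂ (Fin 3)} {z : ℂ}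
    (hG : DifferentiableAt ℝ G z) (X : ℂ) (i : Fin 3) :
    fderiv ℝ G z X i = fderiv ℝ (fun w => G w i) z X := by
  let P : EuclideanSpace ℂ (Fin 3) →L[ℝ] ℂ :=
    (EuclideanSpace.proj (𝕜 := ℂ) i).restrictScalars ℝ
  have h : HasFDerivAt (fun w => G w i) (P.comp (fderiv ℝ G z)) z :=
    P.hasFDerivAt.comp z hG.hasFDerivAt
  rw [h.fderiv]
  rfl

section Coefficients

variable {a b q : ℂ → ℂ} {z : ℂ} (ha : DifferentiableAt ℝ a z) (hb : DifferentiableAt ℝ b z)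
  (hq : DifferentiableAt ℂ q z) (hq0 : q z ≠ 0)

include ha hb hq hq0

/-- The function is `ω(∂_z)` when `a`, `b`, `q` are the coefficients of `u`, `v`, `e²`. -/
lemma differentiableAt_smul_theta :
    DifferentiableAt ℝ (fun w => (q w)⁻¹ • theta (a w) (b w)) z := by
  have hq' : DifferentiableAt ℝ (fun w => (q w)⁻¹) z := (hq.inv hq0).restrictScalars ℝ
  refine (differentiableAt_piLp (𝕜 := ℝ) 2).2 fun i => ?_
  fin_cases i <;> simp [theta] <;> fun_prop

/-- The factor `q⁻¹` is holomorphic, so `∂̄` passes through it and differentiates only the quadratic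
polynomials of `θ`. -/
lemma fderiv_smul_theta_dbar :
    (∀ i, (Complex.I * (fderiv ℝ (fun w => (q w)⁻¹ • theta (a w) (b w)) z 1 +
        Complex.I • fderiv ℝ (fun w => (q w)⁻¹ • theta (a w) (b w)) z Complex.I) i).re = 0) ↔
    ((Complex.I * ((q z)⁻¹ * (2 * a z * dbar a z - 2 * b z * dbar b z))).re = 0 ∧
      (Complex.I * ((q z)⁻¹ * (Complex.I * (2 * a z * dbar a z + 2 * b z * dbar b z)))).re = 0 ∧
      (Complex.I * ((q z)⁻¹ * (2 * (a z * dbar b z + b z * dbar a z)))).re = 0) := by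
  have hq' : DifferentiableAt ℝ (fun w => (q w)⁻¹) z := (hq.inv hq0).restrictScalars ℝ
  have hqz : dbar (fun w => (q w)⁻¹) z = 0 := dbar_eq_zero (hq.inv hq0)
  have hI : DifferentiableAt ℝ (fun _ : ℂ => Complex.I) z := by fun_prop
  have h2 : DifferentiableAt ℝ (fun _ : ℂ => (2 : ℂ)) z := by fun_prop
  have hIz : dbar (fun _ : ℂ => Complex.I) z = 0 := dbar_eq_zero (by fun_prop)
  have h2z : dbar (fun _ : ℂ => (2 : ℂ)) z = 0 := dbar_eq_zero (by fun_prop)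
  have hG := differentiableAt_smul_theta ha hb hq hq0
  have key : ∀ i, (fderiv ℝ (fun w => (q w)⁻¹ • theta (a w) (b w)) z 1 +
      Complex.I • fderiv ℝ (fun w => (q w)⁻¹ • theta (a w) (b w)) z Complex.I) i =
      dbar (fun w => (q w)⁻¹ * theta (a w) (b w) i) z := by
    intro i
    rw [PiLp.add_apply, PiLp.smul_apply, fderiv_euclidean_apply hG, fderiv_euclidean_apply hG]
    rfl
  have k0 : dbar (fun w => (q w)⁻¹ * theta (a w) (b w) 0) z =
      (q z)⁻¹ * (2 * a z * dbar a z - 2 * b z * dbar b z) := by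
    have e : (fun w => (q w)⁻¹ * theta (a w) (b w) 0) =
        fun w => (q w)⁻¹ * (a w * a w - b w * b w) := by
      funext w
      change (q w)⁻¹ * (a w ^ 2 - b w ^ 2) = _
      ring
    rw [e, dbar_mul hq' (by fun_prop), dbar_sub (by fun_prop) (by fun_prop), dbar_mul ha ha,
      dbar_mul hb hb, hqz]
    ring
  have k1 : dbar (fun w => (q w)⁻¹ * theta (a w) (b w) 1) z =
      (q z)⁻¹ * (Complex.I * (2 * a z * dbar a z + 2 * b z * dbar b z)) := by
    have e : (fun w => (q w)⁻¹ * theta (a w) (b w) 1) =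
        fun w => (q w)⁻¹ * (Complex.I * (a w * a w + b w * b w)) := by
      funext w
      change (q w)⁻¹ * (Complex.I * (a w ^ 2 + b w ^ 2)) = _
      ring
    rw [e, dbar_mul hq' (by fun_prop), dbar_mul hI (by fun_prop),
      dbar_add (by fun_prop) (by fun_prop), dbar_mul ha ha, dbar_mul hb hb, hqz, hIz]
    ring
  have k2 : dbar (fun w => (q w)⁻¹ * theta (a w) (b w) 2) z =
      (q z)⁻¹ * (2 * (a z * dbar b z + b z * dbar a z)) := by
    have e : (fun w => (q w)⁻¹ * theta (a w) (b w) 2) =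
        fun w => (q w)⁻¹ * (2 * (a w * b w)) := by
      funext w
      change (q w)⁻¹ * (2 * a w * b w) = _
      ring
    rw [e, dbar_mul hq' (by fun_prop), dbar_mul h2 (by fun_prop), dbar_mul ha hb, hqz, h2z]
    ring
  rw [Fin.forall_fin_succ, Fin.forall_fin_two]
  simp only [key]
  rw [k0, show Fin.succ (0 : Fin 2) = 1 from rfl, show Fin.succ (1 : Fin 2) = 2 from rfl, k1, k2]

end Coefficients

/-- The coefficient of a section of `S^{*1,0}` in the local frame and in the chart at `p`. -/
noncomputable def coeff (ξ : ∀ p : M, S p →ₗ[ℂ] ℂ) (p : M) (z : ℂ) : ℂ :=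
  ξ ((extChartAt 𝓘(ℝ, ℂ) p).symm z) (localFrame S p ((extChartAt 𝓘(ℝ, ℂ) p).symm z))

lemma coeff_self (ξ : ∀ p : M, S p →ₗ[ℂ] ℂ) (p : M) :
    coeff ξ p (extChartAt 𝓘(ℝ, ℂ) p p) = ξ p (localFrame S p p) := by
  rw [coeff, extChartAt_to_inv]

lemma conj_eq_re_sub (c : ℂ) : conj c = c.re - c.im * Complex.I := by
  apply Complex.ext <;> simp

lemma fderiv_apply_eq (f : ℂ → ℂ) (z X : ℂ) :
    fderiv ℝ f z X = X.re * fderiv ℝ f z 1 + X.im * fderiv ℝ f z Complex.I := by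
  have h : X = X.re • (1 : ℂ) + X.im • Complex.I := by simp
  conv_lhs => rw [h, map_add, map_smul, map_smul, Complex.real_smul, Complex.real_smul]

variable {ξ : ∀ p : M, S p →ₗ[ℂ] ℂ}
  (hξ : ContMDiff (𝓘(ℝ, ℂ).prod 𝓘(ℝ, ℂ)) 𝓘(ℝ, ℂ) ∞ (fun w : TotalSpace ℂ S => ξ w.1 w.2))

include hξ

lemma differentiableAt_coeff (p : M) :
    DifferentiableAt ℝ (coeff ξ p) (extChartAt 𝓘(ℝ, ℂ) p p) :=
  differentiableAt_comp_chart_symm ((contMDiffAt_coeff hξ p).mdifferentiableAt (by simp))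

/-- This is `∂̄f = f_z̄ dz̄` at `p`; the `/ 2` appears because `dbar` is twice `f_z̄`. -/
lemma delbar_coeff (p : M) (X : ℂ) :
    delbar (fun x => ξ x (localFrame S p x)) p X =
      conj X * (dbar (coeff ξ p) (extChartAt 𝓘(ℝ, ℂ) p p) / 2) := by
  have h := (contMDiffAt_coeff hξ p).mdifferentiableAt (by simp)
  change (realDiff _ p X + Complex.I * realDiff _ p (Complex.I * X)) / 2 = _
  rw [realDiff_eq_fderiv h, realDiff_eq_fderiv h, fderiv_apply_eq, fderiv_apply_eq _ _ (_ * _),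
    dbar, conj_eq_re_sub]
  simp only [Complex.mul_re, Complex.mul_im, Complex.I_re, Complex.I_im]
  change _ = (_ - _) * ((fderiv ℝ ((fun x => ξ x (localFrame S p x)) ∘ _) _ 1 +
    Complex.I * fderiv ℝ ((fun x => ξ x (localFrame S p x)) ∘ _) _ Complex.I) / 2)
  push_cast
  linear_combination (X.im / 2 * fderiv ℝ ((fun x => ξ x (localFrame S p x)) ∘
    (extChartAt 𝓘(ℝ, ℂ) p).symm) (extChartAt 𝓘(ℝ, ℂ) p p) Complex.I) * Complex.I_sq

/-- Conjugation exchanges the two types: `∂(f̄)` is the conjugate of `∂̄f`, so this is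
`delbar_coeff` conjugated. -/
lemma del_conj_coeff (p : M) (X : ℂ) :
    del (fun x => conj (ξ x (localFrame S p x))) p X =
      X * conj (dbar (coeff ξ p) (extChartAt 𝓘(ℝ, ℂ) p p) / 2) := by
  have h := (contMDiffAt_coeff hξ p).mdifferentiableAt (by simp)
  have hconj : MDifferentiableAt 𝓘(ℝ, ℂ) 𝓘(ℝ, ℂ) (conj : ℂ → ℂ) (ξ p (localFrame S p p)) :=
    (Complex.conjCLE.differentiableAt).mdifferentiableAt
  have h' : MDifferentiableAt 𝓘(ℝ, ℂ) 𝓘(ℝ, ℂ) (fun x => conj (ξ x (localFrame S p x))) p :=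
    hconj.comp p h
  have hD : ∀ Y, realDiff (fun x => conj (ξ x (localFrame S p x))) p Y =
      conj (realDiff (fun x => ξ x (localFrame S p x)) p Y) := by
    intro Y
    have hc := Complex.conjCLE.toContinuousLinearMap.hasFDerivAt.comp _
      (differentiableAt_coeff hξ p).hasFDerivAt
    exact (realDiff_eq_fderiv h' Y).trans
      ((congrArg (fun L : ℂ →L[ℝ] ℂ => L Y) hc.fderiv).trans
        (congrArg conj (realDiff_eq_fderiv h Y).symm))
  have hb := congrArg conj (delbar_coeff hξ p X)
  rw [map_mul, Complex.conj_conj] at hb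
  have hst : ∀ s t : ℂ, (conj s - Complex.I * conj t) / 2 = conj ((s + Complex.I * t) / 2) := by
    intro s t
    rw [map_div₀, map_add, map_mul, Complex.conj_I, map_ofNat]
    ring
  refine Eq.trans ?_ hb
  exact (congrArg₂ (fun s t : ℂ => (s - Complex.I * t) / 2) (hD X)
    (hD (Complex.I * X : ℂ))).trans (hst _ _)

end Spinors

/-! ### Dirac operator on the frame, and the pointwise equivalence -/

section Spinors

variable {M : Type*} [TopologicalSpace M]
  {S : M → Type*} [TopologicalSpace (TotalSpace ℂ S)] [∀ p, AddCommGroup (S p)]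
  [∀ p, Module ℂ (S p)] [∀ p, TopologicalSpace (S p)] [FiberBundle ℂ S]

/-- The value of an element of `S^{*1,0} ⊗ S^{*0,1}` on the local frame at `p`. -/
noncomputable def frameEval (p : M) :
    (S p →ₗ[ℂ] ℂ) ⊗[ℂ] (S p →ₛₗ[starRingEnd ℂ] ℂ) →ₗ[ℂ] ℂ :=
  TensorProduct.lift (LinearMap.mk₂ ℂ
    (fun (ξ : S p →ₗ[ℂ] ℂ) (η : S p →ₛₗ[starRingEnd ℂ] ℂ) =>
      ξ (localFrame S p p) * η (localFrame S p p))
    (fun ξ ξ' η => by rw [LinearMap.add_apply, add_mul])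
    (fun c ξ η => by rw [LinearMap.smul_apply, smul_mul_assoc])
    (fun ξ η η' => by rw [LinearMap.add_apply, mul_add])
    (fun c ξ η => by rw [LinearMap.smul_apply, mul_smul_comm]))

lemma frameEval_tmul (p : M) (ξ : S p →ₗ[ℂ] ℂ) (η : S p →ₛₗ[starRingEnd ℂ] ℂ) :
    frameEval p (ξ ⊗ₜ[ℂ] η) = ξ (localFrame S p p) * η (localFrame S p p) := rfl

variable [VectorBundle ℂ ℂ S]

/-- Elements of the line `S^{*1,0} ⊗ S^{*0,1}` are determined by their value on the frame. -/
lemma frameEval_injective (p : M) : Function.Injective (frameEval (S := S) p) := by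
  -- The tensor `e* ⊗ ē*` takes the value `1` on the frame and spans the line.
  have key : ∀ t, t = frameEval p t •
      ((fiberCoord S p).toLinearMap ⊗ₜ[ℂ] conjPos (fiberCoord S p).toLinearMap) := by
    intro t
    induction t using TensorProduct.induction_on with
    | zero => rw [map_zero, zero_smul]
    | add x y hx hy => rw [map_add, add_smul, ← hx, ← hy]
    | tmul ξ η =>
      have hξ : ξ = ξ (localFrame S p p) • (fiberCoord S p).toLinearMap := by
        ext w
        conv_lhs => rw [← fiberCoord_smul_localFrame p w, map_smul]
        simp [mul_comm]
      have hη : η = η (localFrame S p p) • conjPos (fiberCoord S p).toLinearMap := by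
        ext w
        conv_lhs => rw [← fiberCoord_smul_localFrame p w, LinearMap.map_smulₛₗ]
        simp [conjPos, mul_comm]
      rw [frameEval_tmul]
      conv_lhs => rw [hξ, hη]
      rw [TensorProduct.smul_tmul_smul]
  intro s t h
  rw [key s, key t, h]

variable [ChartedSpace ℂ M] [IsManifold 𝓘(ℂ, ℂ) ω M] [ContMDiffVectorBundle ω ℂ S 𝓘(ℂ, ℂ)]

namespace SquareRoot

variable (Q : SquareRoot S) (W : WeierstrassRepresentation M)

/-- The square of the local frame at `p`, as a complex number in the preferred chart. -/
noncomputable def frameSq (p : M) : ℂ := Q.sq p (localFrame S p p)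

/-- Evaluate `τ_{0,1}(Dξ) = ∂̄ξ` at `(e², e)`: the left side is `Dξ(e) √h(e, e)`, and `√h(e, e) =
‖ω(e²)‖`. -/
lemma diracPos_localFrame (ξ : ∀ p : M, S p →ₗ[ℂ] ℂ) (p : M) :
    Q.diracPos W ξ p (localFrame S p p) =
      delbar (fun x => ξ x (localFrame S p x)) p (Q.sq p (localFrame S p p)) /
        (‖W.form p (Q.sq p (localFrame S p p))‖ : ℂ) := by
  have h : Q.tauNegHom W p (Q.diracPos W ξ p) = dolbeaultPos ξ p :=
    (Q.tauNeg W p).apply_symm_apply (dolbeaultPos ξ p)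
  have h2 : Q.tauNegHom W p (Q.diracPos W ξ p) (Q.sq p (localFrame S p p)) (localFrame S p p) =
      delbar (fun x => ξ x (localFrame S p x)) p (Q.sq p (localFrame S p p)) *
        fiberCoord S p (localFrame S p p) :=
    congrArg (fun η => η (Q.sq p (localFrame S p p)) (localFrame S p p)) h
  rw [tauNegHom_apply_sq, sqrtMetric_apply, fiberCoord_localFrame, map_one, mul_one, one_mul,
    mul_one] at h2
  rw [← h2, mul_div_cancel_right₀ _ (Q.norm_form_ne_zero W p)]

lemma diracNeg_localFrame (ξ : ∀ p : M, S p →ₛₗ[starRingEnd ℂ] ℂ) (p : M) :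
    Q.diracNeg W ξ p (localFrame S p p) =
      del (fun x => ξ x (localFrame S p x)) p (Q.sq p (localFrame S p p)) /
        (‖W.form p (Q.sq p (localFrame S p p))‖ : ℂ) := by
  have h : Q.tauPosHom W p (Q.diracNeg W ξ p) = dolbeaultNeg ξ p :=
    (Q.tauPos W p).apply_symm_apply (dolbeaultNeg ξ p)
  have h2 : Q.tauPosHom W p (Q.diracNeg W ξ p) (Q.sq p (localFrame S p p)) (localFrame S p p) =
      del (fun x => ξ x (localFrame S p x)) p (Q.sq p (localFrame S p p)) *
        conj (fiberCoord S p (localFrame S p p)) :=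
    congrArg (fun η => η (Q.sq p (localFrame S p p)) (localFrame S p p)) h
  rw [tauPosHom_apply_sq, sqrtMetric_apply, fiberCoord_localFrame, map_one, mul_one, one_mul,
    mul_one] at h2
  rw [← h2, mul_div_cancel_right₀ _ (Q.norm_form_ne_zero W p)]

end SquareRoot

/-- The integrability condition at a point, in terms of the coefficients of the spinors. -/
lemma integrable_at_iff (W : WeierstrassRepresentation M) (R : SpinorRepresentation S)
    (hR : R.CorrespondsTo W) (p : M) :
    (∀ (X : Fin 2 → TangentSpace 𝓘(ℝ, ℂ) p) (i : Fin 3),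
      (extDerivOneForm W.realForm p X i).re = 0) ↔
    ((Complex.I * ((R.frameSq p)⁻¹ *
        (2 * R.u p (localFrame S p p) * dbar (coeff R.u p) (extChartAt 𝓘(ℝ, ℂ) p p) -
          2 * R.v p (localFrame S p p) * dbar (coeff R.v p) (extChartAt 𝓘(ℝ, ℂ) p p)))).re = 0 ∧
      (Complex.I * ((R.frameSq p)⁻¹ * (Complex.I *
        (2 * R.u p (localFrame S p p) * dbar (coeff R.u p) (extChartAt 𝓘(ℝ, ℂ) p p) +
          2 * R.v p (localFrame S p p) * dbar (coeff R.v p) (extChartAt 𝓘(ℝ, ℂ) p p))))).re = 0 ∧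
      (Complex.I * ((R.frameSq p)⁻¹ *
        (2 * (R.u p (localFrame S p p) * dbar (coeff R.v p) (extChartAt 𝓘(ℝ, ℂ) p p) +
          R.v p (localFrame S p p) * dbar (coeff R.u p) (extChartAt 𝓘(ℝ, ℂ) p p))))).re = 0) := by
  obtain ⟨q, hq, hqp, hqz⟩ := R.exists_holomorphic_coeff p
  have ha := differentiableAt_coeff R.smooth_u p
  have hb := differentiableAt_coeff R.smooth_v p
  have hq0 : q (extChartAt 𝓘(ℝ, ℂ) p p) ≠ 0 := by
    rw [hqp]; exact R.sq_localFrame_ne_zero p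
  rw [show R.frameSq p = _ from hqp.symm, ← coeff_self R.u p, ← coeff_self R.v p,
    ← fderiv_smul_theta_dbar ha hb hq hq0]
  set z := extChartAt 𝓘(ℝ, ℂ) p p with hz
  set G : ℂ → EuclideanSpace ℂ (Fin 3) :=
    fun w => (q w)⁻¹ • theta (coeff R.u p w) (coeff R.v p w) with hGdef
  have hG : DifferentiableAt ℝ G z := differentiableAt_smul_theta ha hb hq hq0
  let α : ℂ → ℂ →L[ℝ] EuclideanSpace ℂ (Fin 3) := fun w =>
    (W.realForm ((extChartAt 𝓘(ℝ, ℂ) p).symm w)).comp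
      (mfderiv 𝓘(ℝ, ℂ) 𝓘(ℝ, ℂ) (extChartAt 𝓘(ℝ, ℂ) p).symm w)
  -- Since `c ∂_z = (c / q) e²` wherever `q ≠ 0`, correspondence gives `ω(c ∂_z) = (c / q) θ(u(e),
  -- v(e))`.
  have hα : ∀ᶠ w in 𝓝 z, ∀ c, α w c = c • G w := by
    filter_upwards [hqz, hq.continuousAt.eventually_ne hq0] with w hw hw0 c
    have h1 := hw (c * (q w)⁻¹)
    rw [mul_assoc, inv_mul_cancel₀ hw0, mul_one] at h1
    have h2 : α w c = W.form ((extChartAt 𝓘(ℝ, ℂ) p).symm w) ((c * (q w)⁻¹) •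
      R.sq ((extChartAt 𝓘(ℝ, ℂ) p).symm w) (localFrame S p ((extChartAt 𝓘(ℝ, ℂ) p).symm w))) :=
      congrArg (W.form ((extChartAt 𝓘(ℝ, ℂ) p).symm w)) h1
    rw [h2, map_smul, hR, mul_smul]
    rfl
  have hext : ∀ X : Fin 2 → ℂ, extDerivOneForm W.realForm p X =
      ((((X 0).re * (X 1).im - (X 1).re * (X 0).im : ℝ) : ℂ) * Complex.I) •
        (fderiv ℝ G z 1 + Complex.I • fderiv ℝ G z Complex.I) := by
    intro X
    rw [← extDeriv_smul_dz hG hα X]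
    change extDeriv (fun w => ContinuousAlternatingMap.ofSubsingleton ℝ ℂ _ (0 : Fin 1) (α w)) z
      (fun j => (mfderiv 𝓘(ℝ, ℂ) 𝓘(ℝ, ℂ) (extChartAt 𝓘(ℝ, ℂ) p) p : ℂ → ℂ) (X j)) = _
    simp only [mfderiv_chart_self_real]
  constructor
  · intro h i
    -- On the positive unit frame `(1, I)` the area factor is `1`; for any other pair it is a real
    -- multiple, which gives the converse.
    have h1 := h (![1, Complex.I] : Fin 2 → ℂ) i
    rw [hext] at h1
    simpa [add_comm] using h1
  · intro h X i
    have h1 := h i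
    rw [hext X, PiLp.smul_apply, smul_eq_mul, mul_assoc, Complex.re_ofReal_mul, h1, mul_zero]

/-- The integrability condition at a point is equivalent to the two Dirac identities there. -/
lemma integrable_at_iff_dirac (W : WeierstrassRepresentation M) (R : SpinorRepresentation S)
    (hR : R.CorrespondsTo W) (p : M) :
    (∀ (X : Fin 2 → TangentSpace 𝓘(ℝ, ℂ) p) (i : Fin 3),
      (extDerivOneForm W.realForm p X i).re = 0) ↔
    (R.v p ⊗ₜ[ℂ] R.diracPos W R.v p =
        -(R.diracNeg W (fun x => conjPos (R.u x)) p ⊗ₜ[ℂ] conjPos (R.u p))) ∧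
      (R.u p ⊗ₜ[ℂ] R.diracPos W R.v p + R.v p ⊗ₜ[ℂ] R.diracPos W R.u p =
        R.diracNeg W (fun x => conjPos (R.v x)) p ⊗ₜ[ℂ] conjPos (R.u p) +
          R.diracNeg W (fun x => conjPos (R.u x)) p ⊗ₜ[ℂ] conjPos (R.v p)) := by
  have hpos : ∀ {ξ : ∀ p : M, S p →ₗ[ℂ] ℂ}, ContMDiff (𝓘(ℝ, ℂ).prod 𝓘(ℝ, ℂ)) 𝓘(ℝ, ℂ) ∞
      (fun w : TotalSpace ℂ S => ξ w.1 w.2) → R.diracPos W ξ p (localFrame S p p) =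
        conj (R.frameSq p) * (dbar (coeff ξ p) (extChartAt 𝓘(ℝ, ℂ) p p) / 2) /
          (‖W.form p (R.sq p (localFrame S p p))‖ : ℂ) := fun hξ => by
    rw [R.diracPos_localFrame]
    exact congrArg (· / _) (delbar_coeff hξ p _)
  have hneg : ∀ {ξ : ∀ p : M, S p →ₗ[ℂ] ℂ}, ContMDiff (𝓘(ℝ, ℂ).prod 𝓘(ℝ, ℂ)) 𝓘(ℝ, ℂ) ∞
      (fun w : TotalSpace ℂ S => ξ w.1 w.2) →
      R.diracNeg W (fun x => conjPos (ξ x)) p (localFrame S p p) =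
        R.frameSq p * conj (dbar (coeff ξ p) (extChartAt 𝓘(ℝ, ℂ) p p) / 2) /
          (‖W.form p (R.sq p (localFrame S p p))‖ : ℂ) := fun hξ => by
    rw [R.diracNeg_localFrame]
    exact congrArg (· / _) (del_conj_coeff hξ p _)
  -- The tensor identities live in a complex line, so they may be tested on the frame, where they
  -- become the scalar identities of `integrability_algebra` with `N = ‖ω(e²)‖`.
  rw [integrable_at_iff W R hR p,
    integrability_algebra _ _ _ _ _ (show R.frameSq p ≠ 0 from R.sq_localFrame_ne_zero p)
      _ (R.norm_form_ne_zero W p),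
    ← (frameEval_injective (S := S) p).eq_iff, ← (frameEval_injective (S := S) p).eq_iff]
  simp only [map_neg, map_add, frameEval_tmul, hpos R.smooth_u, hpos R.smooth_v,
    hneg R.smooth_u, hneg R.smooth_v]
  exact Iff.rfl

end Spinors

end SpinorSurface

theorem mainTheorem11 {M : Type*} [TopologicalSpace M] [ChartedSpace ℂ M]
    [IsManifold 𝓘(ℂ, ℂ) ω M]
    {S : M → Type*} [TopologicalSpace (TotalSpace ℂ S)] [∀ p, AddCommGroup (S p)]
    [∀ p, Module ℂ (S p)] [∀ p, TopologicalSpace (S p)] [FiberBundle ℂ S] [VectorBundle ℂ ℂ S]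
    [ContMDiffVectorBundle ω ℂ S 𝓘(ℂ, ℂ)]
    (W : SpinorSurface.WeierstrassRepresentation M) (R : SpinorSurface.SpinorRepresentation S)
    (hR : R.CorrespondsTo W) :
    W.Integrable ↔
      (∀ p : M, R.v p ⊗ₜ[ℂ] R.diracPos W R.v p =
          -(R.diracNeg W (fun x => SpinorSurface.conjPos (R.u x)) p ⊗ₜ[ℂ]
            SpinorSurface.conjPos (R.u p))) ∧
      (∀ p : M, R.u p ⊗ₜ[ℂ] R.diracPos W R.v p + R.v p ⊗ₜ[ℂ] R.diracPos W R.u p =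
          R.diracNeg W (fun x => SpinorSurface.conjPos (R.v x)) p ⊗ₜ[ℂ]
              SpinorSurface.conjPos (R.u p) +
            R.diracNeg W (fun x => SpinorSurface.conjPos (R.u x)) p ⊗ₜ[ℂ]
              SpinorSurface.conjPos (R.v p)) := by
  rw [← forall_and]
  exact forall_congr' fun p => SpinorSurface.integrable_at_iff_dirac W R hR p
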